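/- Let $\mathcal H_d=\mathbb C^d$ and let $\mathcal E_0,\mathcal E_1:\mathcal B(\mathcal H_d)\to\mathcal B(\mathcal H_d)$ be quantum operations, that is, maps $\rho\mapsto\sum_{i=1}^m E_i\rho E_i^\dagger$ with $\sum_i E_i^\dagger E_i=I$; let $\mathcal I$ be the identity operation. For states $\rho_0,\rho_1$ put $$\tilde F(\rho_0,\rho_1)=\max\{|\langle\psi_0|\psi_1\rangle| : |\psi_k\rangle\in\mathrm{supp}(\rho_k)\text{ unit vectors},\ k=0,1\},$$ where $\mathrm{supp}(\rho)$ is the span of the eigenvectors of $\rho$ with positive eigenvalue. For quantum operations $\mathcal F_0,\mathcal F_1$ and $0\le q\le 1$ put $$\tilde F_q(\mathcal F_0,\mathcal F_1)=\min\{\tilde F(\mathcal F_0(|\psi_0\rangle\langle\psi_0|),\mathcal F_1(|\psi_1\rangle\langle\psi_1|)) : |\psi_0\rangle,|\psi_1\rangle\text{ unit vectors},\ \langle\psi_0|\psi_1\rangle=q\},$$ and let $\tilde F_q^{ea}(\mathcal F_0,\mathcal F_1)=\tilde F_q(\mathcal I^R\otimes\mathcal F_0,\mathcal I^R\otimes\mathcal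 F_1)$, where $R$ is an auxiliary system of the same dimension as the input system. A general scheme with $N$ queries to an unknown operation $X\in\{\mathcal E_0,\mathcal E_1\}$ consists of an initial state of $\mathcal H_d$ together with a finite-dimensional auxiliary system; then $N$ rounds, each consisting of one application of $X$ to $\mathcal H_d$ (and the identity to the auxiliary system) followed by a known quantum operation on the joint system, which may change the auxiliary system; and a final two-outcome measurement of the joint system. The operations $\mathcal E_0,\mathcal E_1$ are perfectly distinguishable if for some $N$ there is such a scheme whose measurement identifies $X$ with probability one, whether $X=\mathcal E_0$ or $X=\mathcal E_1$; the least such $N$ is the optimal query number $N_{\min}$. If $\mathcal E_0$ and $\mathcal E_1$ are perfectly distinguishable, then $\arccos\tilde F_1^{ea}(\mathcal E_0,\mathcal I)+\arccos\tilde F_1^{ea}(\mathcal E_1,\mathcal I)>0$ and $$N_{\min}\ \ge\ \left\lceil\frac{\pi}{2\left(\arccos\tilde F_1^{ea}(\mathcal E_0,\mathcal I)+\arccos\tilde F_1^{ea}(\mathcal E_1,\mathcal I)\right)}\right\rceil .$$ -/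

import Mathlib

open scoped Matrix ComplexOrder

noncomputable section

namespace QDisc

/-- Quantum operations from operators on `ℂⁿ` to operators on `ℂᵐ`: maps of the form
`ρ ↦ ∑ i, K i * ρ * (K i)ᴴ` with finitely many Kraus operators, `∑ i, (K i)ᴴ * K i = 1`. -/
def IsQuantumOperation {n m : Type} [Fintype n] [DecidableEq n] [Fintype m]
    (E : Matrix n n ℂ →ₗ[ℂ] Matrix m m ℂ) : Prop :=
  ∃ (k : ℕ) (K : Fin k → Matrix m n ℂ),
    ∑ i, (K i)ᴴ * K i = 1 ∧ ∀ ρ, E ρ = ∑ i, K i * ρ * (K i)ᴴ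

/-- Density operators: positive operators of trace one. -/
def IsState {n : Type} [Fintype n] (ρ : Matrix n n ℂ) : Prop :=
  ρ.PosSemidef ∧ ρ.trace = 1

/-- `|ψ⟩⟨ψ|`, the density operator of a pure state when `ψ` is a unit vector. -/
def pure {n : Type} (ψ : EuclideanSpace ℂ n) : Matrix n n ℂ :=
  Matrix.of fun i j => ψ i * star (ψ j)

/-- The support of a positive operator: the span of the eigenvectors whose eigenvalues are
positive. -/
def supp {n : Type} [Fintype n] [DecidableEq n] (ρ : Matrix n n ℂ) :
    Submodule ℂ (EuclideanSpace ℂ n) :=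
  Submodule.span ℂ {ψ | ∃ p : ℝ, 0 < p ∧ Matrix.toEuclideanLin ρ ψ = (p : ℂ) • ψ}

/-- The maximal fidelity of two states: the maximum of `|⟨ψ₀|ψ₁⟩|` over the pure states in
their supports. -/
def maxFidelity {n : Type} [Fintype n] [DecidableEq n] (ρ₀ ρ₁ : Matrix n n ℂ) : ℝ :=
  sSup {t | ∃ ψ₀ ∈ supp ρ₀, ∃ ψ₁ ∈ supp ρ₁, ‖ψ₀‖ = 1 ∧ ‖ψ₁‖ = 1 ∧ t = ‖inner ℂ ψ₀ ψ₁‖}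

/-- The `q`-maximal fidelity of two operations: the minimum of the maximal fidelity of the two
outputs over the pairs of pure inputs with `⟨ψ₀|ψ₁⟩ = q`. -/
def qMaxFidelity {n m : Type} [Fintype n] [Fintype m] [DecidableEq m] (q : ℝ)
    (E₀ E₁ : Matrix n n ℂ →ₗ[ℂ] Matrix m m ℂ) : ℝ :=
  sInf {t | ∃ ψ₀ ψ₁ : EuclideanSpace ℂ n, ‖ψ₀‖ = 1 ∧ ‖ψ₁‖ = 1 ∧ inner ℂ ψ₀ ψ₁ = (q : ℂ) ∧
    t = maxFidelity (E₀ (pure ψ₀)) (E₁ (pure ψ₁))}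

/-- `I ⊗ E`: the operation `E` applied to the second factor of a bipartite system, that is, to
every block of a matrix indexed by `R × n`. -/
def ampliate (R : Type) {n m : Type} (E : Matrix n n ℂ →ₗ[ℂ] Matrix m m ℂ) :
    Matrix (R × n) (R × n) ℂ →ₗ[ℂ] Matrix (R × m) (R × m) ℂ where
  toFun X := Matrix.of fun x y => E (Matrix.of fun a b => X (x.1, a) (y.1, b)) x.2 y.2
  map_add' X Y := by
    ext x y
    exact congrFun (congrFun (E.map_add (Matrix.of fun a b => X (x.1, a) (y.1, b))
      (Matrix.of fun a b => Y (x.1, a) (y.1, b))) x.2) y.2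
  map_smul' c X := by
    ext x y
    exact congrFun (congrFun (E.map_smul c (Matrix.of fun a b => X (x.1, a) (y.1, b))) x.2) y.2

/-- The entanglement-assisted `q`-maximal fidelity; the auxiliary system has the dimension of
the input system. -/
def qMaxFidelityEA {n m : Type} [Fintype n] [Fintype m] [DecidableEq n] [DecidableEq m] (q : ℝ)
    (E₀ E₁ : Matrix n n ℂ →ₗ[ℂ] Matrix m m ℂ) : ℝ :=
  qMaxFidelity q (ampliate n E₀) (ampliate n E₁)

/-- A general (adaptive, entanglement-assisted) scheme for querying an unknown operation on
`ℂᵈ`: an initial state of the system together with an auxiliary system, and, for each `k`, a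
known operation `T k` that is performed on both systems after the `(k+1)`-st query. The
auxiliary systems are arbitrary and may change from step to step. -/
structure Scheme (d : ℕ) where
  r : ℕ → ℕ
  init : Matrix (Fin (r 0) × Fin d) (Fin (r 0) × Fin d) ℂ
  init_state : IsState init
  T : ∀ k, Matrix (Fin (r k) × Fin d) (Fin (r k) × Fin d) ℂ →ₗ[ℂ]
    Matrix (Fin (r (k + 1)) × Fin d) (Fin (r (k + 1)) × Fin d) ℂ
  T_op : ∀ k, IsQuantumOperation (T k)

/-- The joint state after `N` queries to the operation `E`, each followed by the known
operation that the scheme prescribes. -/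
def Scheme.run {d : ℕ} (S : Scheme d) (E : Matrix (Fin d) (Fin d) ℂ →ₗ[ℂ] Matrix (Fin d) (Fin d) ℂ) :
    (N : ℕ) → Matrix (Fin (S.r N) × Fin d) (Fin (S.r N) × Fin d) ℂ
  | 0 => S.init
  | N + 1 => S.T N (ampliate (Fin (S.r N)) E (S.run E N))

/-- `E₀` and `E₁` can be told apart with certainty by `N` queries: for some scheme, a two-outcome
measurement `{M, 1 - M}` of the final state yields the first outcome with probability one if the
unknown operation is `E₀`, and the second with probability one if it is `E₁`. -/
def DistinguishableWith {d : ℕ} (N : ℕ)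
    (E₀ E₁ : Matrix (Fin d) (Fin d) ℂ →ₗ[ℂ] Matrix (Fin d) (Fin d) ℂ) : Prop :=
  ∃ (S : Scheme d) (M : Matrix (Fin (S.r N) × Fin d) (Fin (S.r N) × Fin d) ℂ),
    M.PosSemidef ∧ (1 - M).PosSemidef ∧
      (M * S.run E₀ N).trace = 1 ∧ ((1 - M) * S.run E₁ N).trace = 1

/-- Perfect distinguishability: finitely many queries suffice. -/
def PerfectlyDistinguishable {d : ℕ}
    (E₀ E₁ : Matrix (Fin d) (Fin d) ℂ →ₗ[ℂ] Matrix (Fin d) (Fin d) ℂ) : Prop :=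
  ∃ N, DistinguishableWith N E₀ E₁

/-- The optimal query number (meaningful for perfectly distinguishable operations). -/
def Nmin {d : ℕ} (E₀ E₁ : Matrix (Fin d) (Fin d) ℂ →ₗ[ℂ] Matrix (Fin d) (Fin d) ℂ) : ℕ :=
  sInf {N | DistinguishableWith N E₀ E₁}

end QDisc

end

/-!
Measure the separation of the two possible joint states by the angle `arccos F̃`, the least angle
between pure states in their supports. Initially it is `0`, and a measurement that tells the two
states apart forces the supports to be orthogonal, that is, the angle to be `π / 2`.

A known operation cannot increase the angle: `⟨ψ₀|ψ₁⟩ = ∑ ⟨Kᵢ ψ₀|Kᵢ ψ₁⟩` over its Kraus operators,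
`Kᵢ ψₖ` lies in the support of the `k`-th output, and `∑ ‖Kᵢ ψₖ‖² = 1`, so the Cauchy–Schwarz
inequality applies. A query to `Eₖ` moves a vector of the support of the `k`-th state by at most
`arccos F̃₁ᵉᵃ(Eₖ, I)`; for this the size of the auxiliary system is irrelevant, because the inner
products of the vectors `(1 ⊗ B)|X⟩` depend only on the reduced operator `X * Xᴴ`, which the
vector `|(X * Xᴴ)^(1/2)⟩` shares and which needs an auxiliary system no larger than the input. By
the triangle inequality for `arccos |⟨x|y⟩|`, a query therefore increases the angle by at most the
sum of the two query angles, so that `N` times this sum is at least `π / 2`.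
-/

noncomputable section

namespace QDisc

open Matrix Real

section Support

variable {n m ι : Type} [Fintype n] [DecidableEq n] [Fintype m] [DecidableEq m] [Fintype ι]

theorem supp_eq_range {ρ : Matrix n n ℂ} (hρ : ρ.PosSemidef) :
    supp ρ = LinearMap.range (toEuclideanLin ρ) := by
  refine le_antisymm (Submodule.span_le.2 ?_) ?_
  · rintro ψ ⟨p, hp, hψ⟩
    have hp' : (p : ℂ) ≠ 0 := by exact_mod_cast hp.ne'
    exact ⟨(p : ℂ)⁻¹ • ψ, by rw [map_smul, hψ, inv_smul_smul₀ hp']⟩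
  · rintro _ ⟨ψ, rfl⟩
    set b := hρ.isHermitian.eigenvectorBasis
    have hb (i : n) : toEuclideanLin ρ (b i) = (hρ.isHermitian.eigenvalues i : ℂ) • b i := by
      ext j
      simpa using congrFun (hρ.isHermitian.mulVec_eigenvectorBasis i) j
    rw [← b.sum_repr ψ, map_sum]
    refine Submodule.sum_mem _ fun i _ => ?_
    rw [map_smul]
    refine Submodule.smul_mem _ _ ?_
    rcases (hρ.eigenvalues_nonneg i).eq_or_lt with h0 | hpos
    · simp [hb, ← h0]
    · rw [hb]
      exact Submodule.smul_mem _ _ (Submodule.subset_span ⟨_, hpos, hb i⟩)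

theorem orthogonal_supp {ρ : Matrix n n ℂ} (hρ : ρ.PosSemidef) :
    (supp ρ)ᗮ = LinearMap.ker (toEuclideanLin ρ) := by
  rw [supp_eq_range hρ, (isSymmetric_toEuclideanLin_iff.2 hρ.isHermitian).orthogonal_range]

theorem supp_mul_conjTranspose (A : Matrix n m ℂ) :
    supp (A * Aᴴ) = LinearMap.range (toEuclideanLin A) := by
  rw [supp_eq_range (posSemidef_self_mul_conjTranspose A), toLpLin_mul_same,
    toEuclideanLin_conjTranspose_eq_adjoint, LinearMap.range_self_comp_adjoint]

omit [DecidableEq n] in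
open scoped MatrixOrder in
theorem exists_eq_mul_conjTranspose {ρ : Matrix n n ℂ} (hρ : ρ.PosSemidef) :
    ∃ B : Matrix n n ℂ, ρ = B * Bᴴ := by
  classical exact CStarAlgebra.nonneg_iff_eq_mul_star_self.1 hρ.nonneg

theorem supp_mul_mul_conjTranspose {ρ : Matrix n n ℂ} (hρ : ρ.PosSemidef) (K : Matrix m n ℂ) :
    supp (K * ρ * Kᴴ) = (supp ρ).map (toEuclideanLin K) := by
  obtain ⟨B, rfl⟩ := exists_eq_mul_conjTranspose hρ
  have h : K * (B * Bᴴ) * Kᴴ = K * B * (K * B)ᴴ := by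
    simp only [conjTranspose_mul, Matrix.mul_assoc]
  rw [h, supp_mul_conjTranspose, supp_mul_conjTranspose, toLpLin_mul_same, LinearMap.range_comp]

theorem ker_sum_of_posSemidef {ρ : ι → Matrix n n ℂ} (hρ : ∀ i, (ρ i).PosSemidef) :
    LinearMap.ker (toEuclideanLin (∑ i, ρ i)) = ⨅ i, LinearMap.ker (toEuclideanLin (ρ i)) := by
  ext ψ
  have hker (A : Matrix n n ℂ) (hA : A.PosSemidef) :
      toEuclideanLin A ψ = 0 ↔ star ψ.ofLp ⬝ᵥ A *ᵥ ψ.ofLp = 0 := by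
    rw [hA.dotProduct_mulVec_zero_iff, toLpLin_apply, WithLp.toLp_eq_zero]
  simp only [Submodule.mem_iInf, LinearMap.mem_ker, hker _ (hρ _),
    hker _ (posSemidef_sum _ fun i _ => hρ i), sum_mulVec, dotProduct_sum,
    Finset.sum_eq_zero_iff_of_nonneg fun i _ => (hρ i).dotProduct_mulVec_nonneg ψ.ofLp,
    Finset.mem_univ, true_imp_iff]

theorem supp_sum {ρ : ι → Matrix n n ℂ} (hρ : ∀ i, (ρ i).PosSemidef) :
    supp (∑ i, ρ i) = ⨆ i, supp (ρ i) := by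
  have h : (supp (∑ i, ρ i))ᗮ = (⨆ i, supp (ρ i))ᗮ := by
    simp only [orthogonal_supp (posSemidef_sum _ fun i _ => hρ i), ker_sum_of_posSemidef hρ,
      ← Submodule.iInf_orthogonal, orthogonal_supp (hρ _)]
  simpa only [Submodule.orthogonal_orthogonal] using congrArg Submodule.orthogonal h

theorem supp_sum_mul_mul_conjTranspose {ρ : Matrix n n ℂ} (hρ : ρ.PosSemidef)
    (K : ι → Matrix m n ℂ) :
    supp (∑ i, K i * ρ * (K i)ᴴ) = ⨆ i, (supp ρ).map (toEuclideanLin (K i)) := by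
  simp only [supp_sum fun i => hρ.mul_mul_conjTranspose_same (K i),
    supp_mul_mul_conjTranspose hρ]

omit [Fintype n] [DecidableEq n] in
theorem posSemidef_pure [Finite n] (ψ : EuclideanSpace ℂ n) : (pure ψ).PosSemidef :=
  posSemidef_vecMulVec_self_star ψ.ofLp

theorem supp_pure (ψ : EuclideanSpace ℂ n) : supp (pure ψ) = Submodule.span ℂ {ψ} := by
  have h : pure ψ = replicateCol Unit ψ.ofLp * (replicateCol Unit ψ.ofLp)ᴴ := by
    ext i j
    simp [pure, mul_apply]
  rw [h, supp_mul_conjTranspose]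
  ext φ
  simp only [LinearMap.mem_range, Submodule.mem_span_singleton]
  constructor
  · rintro ⟨c, rfl⟩
    exact ⟨c (), by ext i; simp [toLpLin_apply, mulVec, dotProduct, mul_comm]⟩
  · rintro ⟨c, rfl⟩
    exact ⟨WithLp.toLp 2 fun _ => c, by ext i; simp [toLpLin_apply, mulVec, dotProduct, mul_comm]⟩

omit [DecidableEq n] in
theorem isState_pure {ψ : EuclideanSpace ℂ n} (hψ : ‖ψ‖ = 1) : IsState (pure ψ) := by
  refine ⟨posSemidef_pure ψ, ?_⟩
  calc (pure ψ).trace = inner ℂ ψ ψ := trace_vecMulVec ψ.ofLp (star ψ.ofLp)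
    _ = 1 := by rw [inner_self_eq_norm_sq_to_K, hψ]; simp

theorem exists_unit_mem_supp {ρ : Matrix n n ℂ} (hρ : IsState ρ) : ∃ ψ ∈ supp ρ, ‖ψ‖ = 1 := by
  have hne : supp ρ ≠ ⊥ := by
    intro h
    rw [supp_eq_range hρ.1, LinearMap.range_eq_bot, LinearEquiv.map_eq_zero_iff] at h
    simpa [h] using hρ.2
  obtain ⟨ψ, hψ, hψ0⟩ := (supp ρ).exists_mem_ne_zero_of_ne_bot hne
  exact ⟨(‖ψ‖⁻¹ : ℂ) • ψ, Submodule.smul_mem _ _ hψ, norm_smul_inv_norm hψ0⟩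

theorem toEuclideanLin_eq_zero_of_trace_mul_eq_zero {M ρ : Matrix n n ℂ} (hM : M.PosSemidef)
    (hρ : ρ.PosSemidef) (h : (M * ρ).trace = 0) {ψ : EuclideanSpace ℂ n} (hψ : ψ ∈ supp ρ) :
    toEuclideanLin M ψ = 0 := by
  obtain ⟨A, rfl⟩ := exists_eq_mul_conjTranspose hρ
  have hMA : (Aᴴ * M * A).trace = 0 := by
    rw [Matrix.mul_assoc, trace_mul_comm, Matrix.mul_assoc, h]
  have hMA' : Aᴴ * M * A = 0 := (hM.conjTranspose_mul_mul_same A).trace_eq_zero_iff.1 hMA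
  rw [supp_mul_conjTranspose] at hψ
  obtain ⟨φ, rfl⟩ := hψ
  have hinner : star (A *ᵥ φ.ofLp) ⬝ᵥ M *ᵥ A *ᵥ φ.ofLp = 0 := by
    rw [star_mulVec, ← dotProduct_mulVec, mulVec_mulVec, mulVec_mulVec, hMA', zero_mulVec,
      dotProduct_zero]
  simpa [toLpLin_apply] using (hM.dotProduct_mulVec_zero_iff _).1 hinner

end Support

section Operations

variable {n m : Type} [Fintype n] [DecidableEq n] [Fintype m]

theorem IsQuantumOperation.isState {E : Matrix n n ℂ →ₗ[ℂ] Matrix m m ℂ}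
    (hE : IsQuantumOperation E) {ρ : Matrix n n ℂ} (hρ : IsState ρ) : IsState (E ρ) := by
  obtain ⟨k, K, hK, hE⟩ := hE
  rw [hE]
  refine ⟨posSemidef_sum _ fun i _ => hρ.1.mul_mul_conjTranspose_same _, ?_⟩
  calc (∑ i, K i * ρ * (K i)ᴴ).trace = ((∑ i, (K i)ᴴ * K i) * ρ).trace := by
        simp only [trace_sum, Matrix.sum_mul, trace_mul_cycle (K _) ρ]
    _ = 1 := by rw [hK, Matrix.one_mul, hρ.2]

theorem IsQuantumOperation.supp_map_mono [DecidableEq m]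
    {E : Matrix n n ℂ →ₗ[ℂ] Matrix m m ℂ} (hE : IsQuantumOperation E) {ρ σ : Matrix n n ℂ}
    (hρ : ρ.PosSemidef) (hσ : σ.PosSemidef) (h : supp ρ ≤ supp σ) : supp (E ρ) ≤ supp (E σ) := by
  obtain ⟨k, K, -, hE⟩ := hE
  rw [hE, hE, supp_sum_mul_mul_conjTranspose hρ, supp_sum_mul_mul_conjTranspose hσ]
  exact iSup_mono fun i => Submodule.map_mono h

theorem sum_inner_toEuclideanLin {ι : Type} [Fintype ι] {K : ι → Matrix m n ℂ}
    (hK : ∑ i, (K i)ᴴ * K i = 1) (ψ φ : EuclideanSpace ℂ n) :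
    ∑ i, inner ℂ (toEuclideanLin (K i) ψ) (toEuclideanLin (K i) φ) = inner ℂ ψ φ := by
  classical
  calc ∑ i, inner ℂ (toEuclideanLin (K i) ψ) (toEuclideanLin (K i) φ)
      = ∑ i, inner ℂ ψ (toEuclideanLin ((K i)ᴴ * K i) φ) := by
        simp only [toLpLin_mul_same, toEuclideanLin_conjTranspose_eq_adjoint,
          LinearMap.comp_apply, LinearMap.adjoint_inner_right]
    _ = inner ℂ ψ (toEuclideanLin (∑ i, (K i)ᴴ * K i) φ) := by
        rw [← inner_sum, ← LinearMap.sum_apply, ← map_sum]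
    _ = inner ℂ ψ φ := by rw [hK, toLpLin_one, LinearMap.id_apply]

theorem sum_norm_sq_toEuclideanLin {ι : Type} [Fintype ι] {K : ι → Matrix m n ℂ}
    (hK : ∑ i, (K i)ᴴ * K i = 1) (ψ : EuclideanSpace ℂ n) :
    ∑ i, ‖toEuclideanLin (K i) ψ‖ ^ 2 = ‖ψ‖ ^ 2 := by
  have h := sum_inner_toEuclideanLin hK ψ ψ
  simp only [inner_self_eq_norm_sq_to_K] at h
  exact_mod_cast h

theorem isQuantumOperation_id :
    IsQuantumOperation (LinearMap.id : Matrix n n ℂ →ₗ[ℂ] Matrix n n ℂ) :=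
  ⟨1, fun _ => 1, by simp, by simp⟩

open scoped Kronecker

omit [DecidableEq n] [Fintype m] in
theorem ampliate_eq_sum {R ι : Type} [Fintype R] [DecidableEq R] [Fintype ι]
    {E : Matrix n n ℂ →ₗ[ℂ] Matrix m m ℂ} {K : ι → Matrix m n ℂ}
    (hE : ∀ ρ, E ρ = ∑ i, K i * ρ * (K i)ᴴ) (ρ : Matrix (R × n) (R × n) ℂ) :
    ampliate R E ρ = ∑ i, ((1 : Matrix R R ℂ) ⊗ₖ K i) * ρ * ((1 : Matrix R R ℂ) ⊗ₖ K i)ᴴ := by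
  ext x y
  simp only [ampliate, LinearMap.coe_mk, AddHom.coe_mk, of_apply, hE, Matrix.sum_apply,
    mul_apply, conjTranspose_apply, kroneckerMap_apply, one_apply, Fintype.sum_prod_type, ite_mul,
    one_mul, zero_mul, apply_ite star, star_zero, mul_ite, mul_zero, Finset.sum_ite_irrel,
    Finset.sum_const_zero, Finset.sum_ite_eq, Finset.mem_univ, if_true]

theorem IsQuantumOperation.ampliate (R : Type) [Fintype R] [DecidableEq R]
    {E : Matrix n n ℂ →ₗ[ℂ] Matrix m m ℂ} (hE : IsQuantumOperation E) :
    IsQuantumOperation (ampliate R E) := by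
  obtain ⟨k, K, hK, hE⟩ := hE
  refine ⟨k, fun i => (1 : Matrix R R ℂ) ⊗ₖ K i, ?_, ampliate_eq_sum hE⟩
  calc ∑ i, ((1 : Matrix R R ℂ) ⊗ₖ K i)ᴴ * ((1 : Matrix R R ℂ) ⊗ₖ K i)
      = (1 : Matrix R R ℂ) ⊗ₖ ∑ i, (K i)ᴴ * K i := by
        simp only [conjTranspose_kronecker, conjTranspose_one, ← mul_kronecker_mul,
          Matrix.one_mul]
        exact (map_sum (kroneckerBilinear (R := ℂ) (1 : Matrix R R ℂ)) _ _).symm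
    _ = 1 := by rw [hK, one_kronecker_one]

theorem Scheme.isState_run {d : ℕ} (S : Scheme d)
    {E : Matrix (Fin d) (Fin d) ℂ →ₗ[ℂ] Matrix (Fin d) (Fin d) ℂ} (hE : IsQuantumOperation E) :
    ∀ N, IsState (S.run E N)
  | 0 => S.init_state
  | N + 1 => (S.T_op N).isState ((hE.ampliate _).isState (S.isState_run hE N))

end Operations

section MaxFidelity

variable {n m : Type} [Fintype n] [DecidableEq n] [Fintype m] [DecidableEq m]

theorem maxFidelity_nonneg (ρ₀ ρ₁ : Matrix n n ℂ) : 0 ≤ maxFidelity ρ₀ ρ₁ := by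
  refine Real.sSup_nonneg ?_
  rintro _ ⟨ψ₀, -, ψ₁, -, -, -, rfl⟩
  exact norm_nonneg _

theorem maxFidelity_le {ρ₀ ρ₁ : Matrix n n ℂ} {c : ℝ} (hc : 0 ≤ c)
    (h : ∀ ψ₀ ∈ supp ρ₀, ∀ ψ₁ ∈ supp ρ₁, ‖ψ₀‖ = 1 → ‖ψ₁‖ = 1 → ‖inner ℂ ψ₀ ψ₁‖ ≤ c) :
    maxFidelity ρ₀ ρ₁ ≤ c := by
  refine Real.sSup_le ?_ hc
  rintro _ ⟨ψ₀, hψ₀, ψ₁, hψ₁, hn₀, hn₁, rfl⟩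
  exact h ψ₀ hψ₀ ψ₁ hψ₁ hn₀ hn₁

theorem norm_inner_le_maxFidelity {ρ₀ ρ₁ : Matrix n n ℂ} {ψ₀ ψ₁ : EuclideanSpace ℂ n}
    (hψ₀ : ψ₀ ∈ supp ρ₀) (hψ₁ : ψ₁ ∈ supp ρ₁) (hn₀ : ‖ψ₀‖ = 1) (hn₁ : ‖ψ₁‖ = 1) :
    ‖inner ℂ ψ₀ ψ₁‖ ≤ maxFidelity ρ₀ ρ₁ := by
  refine le_csSup ⟨1, ?_⟩ ⟨ψ₀, hψ₀, ψ₁, hψ₁, hn₀, hn₁, rfl⟩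
  rintro _ ⟨φ₀, -, φ₁, -, hφ₀, hφ₁, rfl⟩
  simpa [hφ₀, hφ₁] using norm_inner_le_norm (𝕜 := ℂ) φ₀ φ₁

theorem norm_inner_le_maxFidelity_mul {ρ₀ ρ₁ : Matrix n n ℂ} {ψ₀ ψ₁ : EuclideanSpace ℂ n}
    (hψ₀ : ψ₀ ∈ supp ρ₀) (hψ₁ : ψ₁ ∈ supp ρ₁) :
    ‖inner ℂ ψ₀ ψ₁‖ ≤ maxFidelity ρ₀ ρ₁ * (‖ψ₀‖ * ‖ψ₁‖) := by
  rcases eq_or_ne ψ₀ 0 with rfl | h₀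
  · simp
  rcases eq_or_ne ψ₁ 0 with rfl | h₁
  · simp
  have h := norm_inner_le_maxFidelity (Submodule.smul_mem _ (‖ψ₀‖⁻¹ : ℂ) hψ₀)
    (Submodule.smul_mem _ (‖ψ₁‖⁻¹ : ℂ) hψ₁) (norm_smul_inv_norm h₀) (norm_smul_inv_norm h₁)
  rw [inner_smul_left, inner_smul_right, norm_mul, norm_mul] at h
  calc ‖inner ℂ ψ₀ ψ₁‖ = ‖ψ₀‖⁻¹ * (‖ψ₁‖⁻¹ * ‖inner ℂ ψ₀ ψ₁‖) * (‖ψ₀‖ * ‖ψ₁‖) := by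
        field_simp [norm_ne_zero_iff.2 h₀, norm_ne_zero_iff.2 h₁]
    _ ≤ maxFidelity ρ₀ ρ₁ * (‖ψ₀‖ * ‖ψ₁‖) := by
        gcongr
        simpa using h

theorem exists_norm_inner_eq_maxFidelity {ρ₀ ρ₁ : Matrix n n ℂ} (hρ₀ : IsState ρ₀)
    (hρ₁ : IsState ρ₁) :
    ∃ ψ₀ ∈ supp ρ₀, ∃ ψ₁ ∈ supp ρ₁, ‖ψ₀‖ = 1 ∧ ‖ψ₁‖ = 1 ∧
      ‖inner ℂ ψ₀ ψ₁‖ = maxFidelity ρ₀ ρ₁ := by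
  let unitSupp (ρ : Matrix n n ℂ) : Set (EuclideanSpace ℂ n) := {ψ | ψ ∈ supp ρ ∧ ‖ψ‖ = 1}
  have hcompact (ρ : Matrix n n ℂ) : IsCompact (unitSupp ρ) := by
    have hset : unitSupp ρ = (supp ρ : Set (EuclideanSpace ℂ n)) ∩ Metric.sphere 0 1 := by
      ext
      simp [unitSupp]
    rw [hset]
    exact (isCompact_sphere 0 1).inter_left (supp ρ).closed_of_finiteDimensional
  have hnonempty {ρ : Matrix n n ℂ} (hρ : IsState ρ) : (unitSupp ρ).Nonempty :=
    exists_unit_mem_supp hρ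
  obtain ⟨⟨ψ₀, ψ₁⟩, ⟨⟨h₀, hn₀⟩, h₁, hn₁⟩, hmax⟩ :=
    ((hcompact ρ₀).prod (hcompact ρ₁)).exists_isMaxOn ((hnonempty hρ₀).prod (hnonempty hρ₁))
      (f := fun x => ‖inner ℂ x.1 x.2‖) (by fun_prop)
  exact ⟨ψ₀, h₀, ψ₁, h₁, hn₀, hn₁, (norm_inner_le_maxFidelity h₀ h₁ hn₀ hn₁).antisymm
    (maxFidelity_le (norm_nonneg _) fun φ₀ hφ₀ φ₁ hφ₁ hm₀ hm₁ =>
      hmax (a := (φ₀, φ₁)) ⟨⟨hφ₀, hm₀⟩, hφ₁, hm₁⟩)⟩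

theorem IsQuantumOperation.maxFidelity_le_map {E : Matrix n n ℂ →ₗ[ℂ] Matrix m m ℂ}
    (hE : IsQuantumOperation E) {ρ₀ ρ₁ : Matrix n n ℂ} (hρ₀ : ρ₀.PosSemidef)
    (hρ₁ : ρ₁.PosSemidef) : maxFidelity ρ₀ ρ₁ ≤ maxFidelity (E ρ₀) (E ρ₁) := by
  obtain ⟨k, K, hK, hE⟩ := hE
  have hmem {ρ : Matrix n n ℂ} (hρ : ρ.PosSemidef) {ψ : EuclideanSpace ℂ n} (hψ : ψ ∈ supp ρ)
      (i : Fin k) : toEuclideanLin (K i) ψ ∈ supp (E ρ) := by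
    rw [hE, supp_sum_mul_mul_conjTranspose hρ]
    exact Submodule.mem_iSup_of_mem i (Submodule.mem_map_of_mem hψ)
  refine maxFidelity_le (maxFidelity_nonneg _ _) fun ψ₀ hψ₀ ψ₁ hψ₁ hn₀ hn₁ => ?_
  set F := maxFidelity (E ρ₀) (E ρ₁)
  calc ‖inner ℂ ψ₀ ψ₁‖
      ≤ ∑ i, ‖inner ℂ (toEuclideanLin (K i) ψ₀) (toEuclideanLin (K i) ψ₁)‖ := by
        rw [← sum_inner_toEuclideanLin hK]
        exact norm_sum_le _ _
    _ ≤ ∑ i, F * (‖toEuclideanLin (K i) ψ₀‖ * ‖toEuclideanLin (K i) ψ₁‖) :=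
        Finset.sum_le_sum fun i _ =>
          norm_inner_le_maxFidelity_mul (hmem hρ₀ hψ₀ i) (hmem hρ₁ hψ₁ i)
    _ = F * ∑ i, ‖toEuclideanLin (K i) ψ₀‖ * ‖toEuclideanLin (K i) ψ₁‖ :=
        (Finset.mul_sum _ _ _).symm
    _ ≤ F * (√(∑ i, ‖toEuclideanLin (K i) ψ₀‖ ^ 2) * √(∑ i, ‖toEuclideanLin (K i) ψ₁‖ ^ 2)) := by
        gcongr
        · exact maxFidelity_nonneg _ _
        · exact sum_mul_le_sqrt_mul_sqrt _ _ _
    _ = F := by simp [sum_norm_sq_toEuclideanLin hK, hn₀, hn₁]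

theorem maxFidelity_self {ρ : Matrix n n ℂ} (hρ : IsState ρ) : maxFidelity ρ ρ = 1 := by
  obtain ⟨ψ, hψ, hn⟩ := exists_unit_mem_supp hρ
  refine le_antisymm (maxFidelity_le zero_le_one fun ψ₀ _ ψ₁ _ h₀ h₁ => ?_) ?_
  · simpa [h₀, h₁] using norm_inner_le_norm (𝕜 := ℂ) ψ₀ ψ₁
  · simpa [inner_self_eq_norm_sq_to_K, hn] using norm_inner_le_maxFidelity hψ hψ hn hn

theorem maxFidelity_eq_zero_of_measurement {M ρ₀ ρ₁ : Matrix n n ℂ} (hM : M.PosSemidef)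
    (hM' : (1 - M).PosSemidef) (hρ₀ : IsState ρ₀) (hρ₁ : IsState ρ₁) (h₀ : (M * ρ₀).trace = 1)
    (h₁ : ((1 - M) * ρ₁).trace = 1) : maxFidelity ρ₀ ρ₁ = 0 := by
  refine le_antisymm (maxFidelity_le le_rfl fun ψ₀ hψ₀ ψ₁ hψ₁ _ _ => ?_) (maxFidelity_nonneg _ _)
  have hfix : toEuclideanLin M ψ₀ = ψ₀ := by
    have h := toEuclideanLin_eq_zero_of_trace_mul_eq_zero hM' hρ₀.1
      (by rw [Matrix.sub_mul, Matrix.one_mul, trace_sub, h₀, hρ₀.2, sub_self]) hψ₀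
    rw [map_sub, LinearMap.sub_apply, sub_eq_zero] at h
    simpa using h.symm
  have hkill : toEuclideanLin M ψ₁ = 0 := toEuclideanLin_eq_zero_of_trace_mul_eq_zero hM hρ₁.1
    (by simpa [Matrix.sub_mul, trace_sub, hρ₁.2] using h₁) hψ₁
  have horth : inner ℂ ψ₀ ψ₁ = 0 := by
    rw [← hfix, isSymmetric_toEuclideanLin_iff.2 hM.isHermitian, hkill, inner_zero_right]
  simp [horth]

end MaxFidelity

section AuxiliarySystem

variable {R n m : Type}

/-- The vector `|X⟩` of a bipartite system `R × n` whose coordinates are the entries of the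
matrix `X`. It turns `1 ⊗ B` into left multiplication by `B`, and its reduced operator on `n` is
`X * Xᴴ`. The rows of `X` are indexed by the second factor, as in `Matrix.vec`. -/
def ket : Matrix n R ℂ ≃ₗ[ℂ] EuclideanSpace ℂ (R × n) where
  toFun X := WithLp.toLp 2 (vec X)
  map_add' _ _ := rfl
  map_smul' _ _ := rfl
  invFun ψ := Matrix.of fun a r => ψ (r, a)
  left_inv _ := rfl
  right_inv _ := rfl

variable [Fintype R] [Fintype n]

theorem inner_ket (X Y : Matrix n R ℂ) : inner ℂ (ket X) (ket Y) = (Xᴴ * Y).trace := by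
  rw [EuclideanSpace.inner_eq_star_dotProduct, dotProduct_comm]
  exact star_vec_dotProduct_vec X Y

open scoped Kronecker in
theorem toEuclideanLin_one_kronecker_ket [DecidableEq R] [DecidableEq n] (B : Matrix m n ℂ)
    (X : Matrix n R ℂ) : toEuclideanLin ((1 : Matrix R R ℂ) ⊗ₖ B) (ket X) = ket (B * X) := by
  have h : ((1 : Matrix R R ℂ) ⊗ₖ B) *ᵥ vec X = vec (B * X) := by
    rw [kronecker_mulVec_vec, transpose_one, Matrix.mul_one]
  exact congrArg (WithLp.toLp 2) h

variable [Fintype m]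

theorem supp_ampliate_pure_ket [DecidableEq R] [DecidableEq m] {ι : Type} [Fintype ι]
    {E : Matrix n n ℂ →ₗ[ℂ] Matrix m m ℂ} {K : ι → Matrix m n ℂ}
    (hE : ∀ ρ, E ρ = ∑ i, K i * ρ * (K i)ᴴ) (X : Matrix n R ℂ) :
    supp (ampliate R E (pure (ket X))) =
      (Submodule.span ℂ (Set.range K)).map (ket.toLinearMap ∘ₗ mulRightLinearMap m ℂ X) := by
  classical
  rw [ampliate_eq_sum hE, supp_sum_mul_mul_conjTranspose (posSemidef_pure _), supp_pure]
  simp only [Submodule.map_span, Set.image_singleton, toEuclideanLin_one_kronecker_ket]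
  rw [← Submodule.span_range_eq_iSup, ← Set.range_comp]
  rfl

theorem inner_ket_mul_eq_trace (X : Matrix n R ℂ) (B C : Matrix m n ℂ) :
    inner ℂ (ket (B * X)) (ket (C * X)) = (Bᴴ * C * (X * Xᴴ)).trace := by
  rw [inner_ket, conjTranspose_mul, Matrix.mul_assoc, trace_mul_comm, ← Matrix.mul_assoc,
    ← Matrix.mul_assoc, Matrix.mul_assoc _ X]

theorem maxFidelity_ampliate_ket_le {R' : Type} [Fintype R'] [DecidableEq R] [DecidableEq R']
    [DecidableEq n] [DecidableEq m] {E₀ E₁ : Matrix n n ℂ →ₗ[ℂ] Matrix m m ℂ}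
    (hE₀ : IsQuantumOperation E₀) (hE₁ : IsQuantumOperation E₁) {X : Matrix n R ℂ}
    {Y : Matrix n R' ℂ} (hXY : X * Xᴴ = Y * Yᴴ) :
    maxFidelity (ampliate R E₀ (pure (ket X))) (ampliate R E₁ (pure (ket X))) ≤
      maxFidelity (ampliate R' E₀ (pure (ket Y))) (ampliate R' E₁ (pure (ket Y))) := by
  obtain ⟨k, K, -, hK⟩ := hE₀
  obtain ⟨l, L, -, hL⟩ := hE₁
  have hinner (B C : Matrix m n ℂ) :
      inner ℂ (ket (B * X)) (ket (C * X)) = inner ℂ (ket (B * Y)) (ket (C * Y)) := by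
    rw [inner_ket_mul_eq_trace, inner_ket_mul_eq_trace, hXY]
  have hnorm (B : Matrix m n ℂ) : ‖ket (B * X)‖ = ‖ket (B * Y)‖ := by
    rw [norm_eq_sqrt_re_inner (𝕜 := ℂ), hinner, ← norm_eq_sqrt_re_inner]
  refine maxFidelity_le (maxFidelity_nonneg _ _) fun ψ₀ hψ₀ ψ₁ hψ₁ hn₀ hn₁ => ?_
  simp only [supp_ampliate_pure_ket hK, supp_ampliate_pure_ket hL] at hψ₀ hψ₁
  obtain ⟨B, hB, rfl⟩ := hψ₀
  obtain ⟨C, hC, rfl⟩ := hψ₁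
  refine (congrArg norm (hinner B C)).trans_le (norm_inner_le_maxFidelity ?_ ?_ ?_ ?_)
  · exact supp_ampliate_pure_ket hK Y ▸ Submodule.mem_map_of_mem hB
  · exact supp_ampliate_pure_ket hL Y ▸ Submodule.mem_map_of_mem hC
  · exact (hnorm B).symm.trans hn₀
  · exact (hnorm C).symm.trans hn₁

theorem qMaxFidelityEA_one_le_maxFidelity [DecidableEq R] [DecidableEq n] [DecidableEq m]
    {E₀ E₁ : Matrix n n ℂ →ₗ[ℂ] Matrix m m ℂ} (hE₀ : IsQuantumOperation E₀)
    (hE₁ : IsQuantumOperation E₁) {ψ : EuclideanSpace ℂ (R × n)} (hψ : ‖ψ‖ = 1) :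
    qMaxFidelityEA 1 E₀ E₁ ≤
      maxFidelity (ampliate R E₀ (pure ψ)) (ampliate R E₁ (pure ψ)) := by
  obtain ⟨X, rfl⟩ := ket.surjective ψ
  obtain ⟨Y, hXY⟩ := exists_eq_mul_conjTranspose (posSemidef_self_mul_conjTranspose X)
  have hn : ‖ket Y‖ = 1 := by
    have h : inner ℂ (ket Y) (ket Y) = inner ℂ (ket X) (ket X) := by
      rw [inner_ket, trace_mul_comm, ← hXY, trace_mul_comm, inner_ket]
    rw [norm_eq_sqrt_re_inner (𝕜 := ℂ), h, ← norm_eq_sqrt_re_inner, hψ]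
  refine le_trans (csInf_le ⟨0, ?_⟩ ⟨ket Y, ket Y, hn, hn, ?_, rfl⟩)
    (maxFidelity_ampliate_ket_le hE₀ hE₁ hXY.symm)
  · rintro _ ⟨φ₀, φ₁, -, -, -, rfl⟩
    exact maxFidelity_nonneg _ _
  · simp [inner_self_eq_norm_sq_to_K, hn]

end AuxiliarySystem

section Angle

theorem arccos_norm_inner_le_add {𝕜 V : Type*} [RCLike 𝕜] [NormedAddCommGroup V]
    [InnerProductSpace 𝕜 V] {x y z : V} (hx : ‖x‖ = 1) (hy : ‖y‖ = 1) (hz : ‖z‖ = 1) :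
    arccos ‖inner 𝕜 x z‖ ≤ arccos ‖inner 𝕜 x y‖ + arccos ‖inner 𝕜 y z‖ := by
  let _ : InnerProductSpace ℝ V := InnerProductSpace.rclikeToReal 𝕜 V
  -- Multiplying `x` and `z` by phases makes both inner products with `y` real and nonnegative.
  obtain ⟨c, hc, hcxy⟩ := RCLike.exists_norm_eq_mul_self (inner 𝕜 x y)
  obtain ⟨d, hd, hdyz⟩ := RCLike.exists_norm_eq_mul_self (inner 𝕜 y z)
  have hangle {u v : V} (hu : ‖u‖ = 1) (hv : ‖v‖ = 1) :
      InnerProductGeometry.angle u v = arccos (RCLike.re (inner 𝕜 u v)) := by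
    simp [InnerProductGeometry.angle, hu, hv, real_inner_eq_re_inner 𝕜]
  have hx' : ‖star c • x‖ = 1 := by simp [norm_smul, hc, hx]
  have hz' : ‖d • z‖ = 1 := by simp [norm_smul, hd, hz]
  have hxy : RCLike.re (inner 𝕜 (star c • x) y) = ‖inner 𝕜 x y‖ := by
    simp [inner_smul_left, ← hcxy]
  have hyz : RCLike.re (inner 𝕜 y (d • z)) = ‖inner 𝕜 y z‖ := by
    simp [inner_smul_right, ← hdyz]
  have hxz : RCLike.re (inner 𝕜 (star c • x) (d • z)) ≤ ‖inner 𝕜 x z‖ := by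
    refine (RCLike.re_le_norm _).trans ?_
    simp [inner_smul_left, inner_smul_right, hc, hd]
  calc arccos ‖inner 𝕜 x z‖ ≤ InnerProductGeometry.angle (star c • x) (d • z) := by
        rw [hangle hx' hz']
        exact arccos_le_arccos hxz
    _ ≤ InnerProductGeometry.angle (star c • x) y + InnerProductGeometry.angle y (d • z) :=
        InnerProductGeometry.angle_le_angle_add_angle _ _ _
    _ = arccos ‖inner 𝕜 x y‖ + arccos ‖inner 𝕜 y z‖ := by
        rw [hangle hx' hy, hangle hy hz', hxy, hyz]

end Angle

section Queries

variable {n : Type} [Fintype n] [DecidableEq n]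

/-- The angle of a query to `E`: the largest angle between a pure state, possibly entangled with
an auxiliary system, and the support of its image under one application of `E`. -/
def queryAngle (E : Matrix n n ℂ →ₗ[ℂ] Matrix n n ℂ) : ℝ :=
  arccos (qMaxFidelityEA 1 E LinearMap.id)

variable {R : Type} [Fintype R] [DecidableEq R]

theorem exists_arccos_norm_inner_le_queryAngle {E : Matrix n n ℂ →ₗ[ℂ] Matrix n n ℂ}
    (hE : IsQuantumOperation E) {ρ : Matrix (R × n) (R × n) ℂ} (hρ : ρ.PosSemidef)
    {ψ : EuclideanSpace ℂ (R × n)} (hψ : ψ ∈ supp ρ) (hn : ‖ψ‖ = 1) :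
    ∃ φ ∈ supp (ampliate R E ρ), ‖φ‖ = 1 ∧ arccos ‖inner ℂ ψ φ‖ ≤ queryAngle E := by
  obtain ⟨φ, hφ, χ, hχ, hφ1, hχ1, hmax⟩ := exists_norm_inner_eq_maxFidelity
    ((hE.ampliate R).isState (isState_pure hn)) (isState_pure hn)
  rw [supp_pure] at hχ
  obtain ⟨c, rfl⟩ := Submodule.mem_span_singleton.1 hχ
  have hc : ‖c‖ = 1 := by simpa [norm_smul, hn] using hχ1
  have hsupp : supp (pure ψ) ≤ supp ρ := by
    rwa [supp_pure, Submodule.span_singleton_le_iff_mem]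
  refine ⟨φ, (hE.ampliate R).supp_map_mono (posSemidef_pure ψ) hρ hsupp hφ, hφ1,
    arccos_le_arccos ?_⟩
  calc qMaxFidelityEA 1 E LinearMap.id
      ≤ maxFidelity (ampliate R E (pure ψ)) (pure ψ) :=
        qMaxFidelityEA_one_le_maxFidelity hE isQuantumOperation_id hn
    _ = ‖inner ℂ ψ φ‖ := by
        rw [← hmax, inner_smul_right, norm_mul, hc, one_mul, norm_inner_symm]

theorem arccos_maxFidelity_ampliate_le {E₀ E₁ : Matrix n n ℂ →ₗ[ℂ] Matrix n n ℂ}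
    (hE₀ : IsQuantumOperation E₀) (hE₁ : IsQuantumOperation E₁)
    {ρ₀ ρ₁ : Matrix (R × n) (R × n) ℂ} (hρ₀ : IsState ρ₀) (hρ₁ : IsState ρ₁) :
    arccos (maxFidelity (ampliate R E₀ ρ₀) (ampliate R E₁ ρ₁)) ≤
      arccos (maxFidelity ρ₀ ρ₁) + (queryAngle E₀ + queryAngle E₁) := by
  obtain ⟨ψ₀, hψ₀, ψ₁, hψ₁, hn₀, hn₁, hmax⟩ := exists_norm_inner_eq_maxFidelity hρ₀ hρ₁
  obtain ⟨φ₀, hφ₀, hm₀, hθ₀⟩ := exists_arccos_norm_inner_le_queryAngle hE₀ hρ₀.1 hψ₀ hn₀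
  obtain ⟨φ₁, hφ₁, hm₁, hθ₁⟩ := exists_arccos_norm_inner_le_queryAngle hE₁ hρ₁.1 hψ₁ hn₁
  rw [norm_inner_symm] at hθ₀
  calc arccos (maxFidelity (ampliate R E₀ ρ₀) (ampliate R E₁ ρ₁))
      ≤ arccos ‖inner ℂ φ₀ φ₁‖ := arccos_le_arccos (norm_inner_le_maxFidelity hφ₀ hφ₁ hm₀ hm₁)
    _ ≤ arccos ‖inner ℂ φ₀ ψ₀‖ + (arccos ‖inner ℂ ψ₀ ψ₁‖ + arccos ‖inner ℂ ψ₁ φ₁‖) := by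
        grw [arccos_norm_inner_le_add hm₀ hn₀ hm₁, arccos_norm_inner_le_add hn₀ hn₁ hm₁]
    _ ≤ arccos (maxFidelity ρ₀ ρ₁) + (queryAngle E₀ + queryAngle E₁) := by
        rw [hmax]
        linarith

variable {d : ℕ} {E₀ E₁ : Matrix (Fin d) (Fin d) ℂ →ₗ[ℂ] Matrix (Fin d) (Fin d) ℂ}

theorem Scheme.arccos_maxFidelity_run_le (S : Scheme d) (hE₀ : IsQuantumOperation E₀)
    (hE₁ : IsQuantumOperation E₁) (N : ℕ) :
    arccos (maxFidelity (S.run E₀ N) (S.run E₁ N)) ≤ N * (queryAngle E₀ + queryAngle E₁) := by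
  induction N with
  | zero => simp [Scheme.run, maxFidelity_self S.init_state]
  | succ N ih =>
    have h₀ := S.isState_run hE₀ N
    have h₁ := S.isState_run hE₁ N
    calc arccos (maxFidelity (S.run E₀ (N + 1)) (S.run E₁ (N + 1)))
        ≤ arccos (maxFidelity (ampliate (Fin (S.r N)) E₀ (S.run E₀ N))
            (ampliate (Fin (S.r N)) E₁ (S.run E₁ N))) :=
          arccos_le_arccos ((S.T_op N).maxFidelity_le_map ((hE₀.ampliate _).isState h₀).1
            ((hE₁.ampliate _).isState h₁).1)
      _ ≤ arccos (maxFidelity (S.run E₀ N) (S.run E₁ N)) + (queryAngle E₀ + queryAngle E₁) :=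
          arccos_maxFidelity_ampliate_le hE₀ hE₁ h₀ h₁
      _ ≤ (N + 1 : ℕ) * (queryAngle E₀ + queryAngle E₁) := by
          push_cast
          linarith

theorem DistinguishableWith.pi_div_two_le {N : ℕ} (h : DistinguishableWith N E₀ E₁)
    (hE₀ : IsQuantumOperation E₀) (hE₁ : IsQuantumOperation E₁) :
    π / 2 ≤ N * (queryAngle E₀ + queryAngle E₁) := by
  obtain ⟨S, M, hM, hM', h₀, h₁⟩ := h
  have hF := maxFidelity_eq_zero_of_measurement hM hM' (S.isState_run hE₀ N)
    (S.isState_run hE₁ N) h₀ h₁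
  simpa [hF] using S.arccos_maxFidelity_run_le hE₀ hE₁ N

end Queries

end QDisc

end

theorem mainTheorem7 {d : ℕ}
    (E₀ E₁ : Matrix (Fin d) (Fin d) ℂ →ₗ[ℂ] Matrix (Fin d) (Fin d) ℂ)
    (hE₀ : QDisc.IsQuantumOperation E₀) (hE₁ : QDisc.IsQuantumOperation E₁)
    (h : QDisc.PerfectlyDistinguishable E₀ E₁) :
    0 < Real.arccos (QDisc.qMaxFidelityEA 1 E₀ LinearMap.id) +
          Real.arccos (QDisc.qMaxFidelityEA 1 E₁ LinearMap.id) ∧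
      ⌈Real.pi / (2 * (Real.arccos (QDisc.qMaxFidelityEA 1 E₀ LinearMap.id) +
          Real.arccos (QDisc.qMaxFidelityEA 1 E₁ LinearMap.id)))⌉₊ ≤ QDisc.Nmin E₀ E₁ := by
  have hN := QDisc.DistinguishableWith.pi_div_two_le (Nat.sInf_mem h) hE₀ hE₁
  have hpos := pos_of_mul_pos_right (Real.pi_div_two_pos.trans_le hN) (Nat.cast_nonneg _)
  refine ⟨hpos, Nat.ceil_le.2 ?_⟩
  rw [← div_div]
  exact (div_le_iff₀ hpos).2 hN
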